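/- Let $H^4=\{p=(p_0,p_1,p_2,p_3)\in\mathbb R^4 : p_0>0\}$ be the upper half-space model of hyperbolic $4$-space, with metric $(dp_0^2+dp_1^2+dp_2^2+dp_3^2)/p_0^2$, let $N=\{p_0=1\}$, a horosphere identified with $\mathbb R^3$ via $p'\mapsto(1,p')$, and let $U=\{0<p_0<1\}$ be its exterior. For a tangent vector $u$ let $\gamma_u$ be the geodesic of $H^4$ with initial velocity $u$. A smooth unit vector field $v$ on $N$ *bifoliates* $U$ if the rays $\gamma_{v(p)}(0,\infty)$, $p\in N$, are the leaves of a smooth foliation of $U$, and so are the rays $\gamma_{-v(p)}(0,\infty)$, $p\in N$. Let $V(t,x,y,z)=(-x,t,-z,y)$ be the Hopf field on $S^3\subset\mathbb R^4$ and $F(t,x,y,z)=\frac1{1-t}(x,y,z)$ the stereographic projection $S^3\setminus\{(1,0,0,0)\}\to\mathbb R^3$. Define $$v(x,y,z)=\frac{1}{x^2+y^2+z^2+1}\bigl(x^2-y^2-z^2+1,\;2xy+2z,\;2xz-2y\bigr).$$ Then $v$ is the normalized image of $-V$ under $F$, that is, $v(F(q))=dF_q(-V(q))/\|dF_q(-V(q))\|$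 for all $q\in S^3\setminus\{(1,0,0,0)\}$. Considered on $N\simeq\mathbb R^3$, $v$ is a smooth unit vector field, and it bifoliates $U$. There is exactly one bijection $B\colon U\to U$ with $B(\gamma_{v(p)}(-t))=\gamma_{v(p)}(t)$ for all $p\in N$, $t>0$ (the outer billiard map). For every $h\in(0,1)$: (a) For all $x\in\mathbb R$ and $m\in\mathbb Z$, $B^m(h,x,0,0)=(h,\,x+2m\sqrt{1-h^2},\,0,\,0)$; in particular the orbit of $(h,x,0,0)$ is unbounded in $H^4$. (b) $B$ preserves the circle $C_h=\{(h,x,y,z) : x=0,\ y^2+z^2=2-h^2\}$, that is, $B(C_h)=C_h$. (c) The restriction of $B$ to $C_h$ is the rotation by the angle $\theta_h=2\arctan\sqrt{1-h^2}$ given by $(h,0,y,z)\mapsto(h,0,\ y\cos\theta_h+z\sin\theta_h,\ -y\sin\theta_h+z\cos\theta_h)$. Hence the orbit of each point of $C_h$ is periodic if and only if $\theta_h$ is a rational multiple of $\pi$. -/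

import Mathlib

open Set Function
open scoped ContDiff

noncomputable section

namespace HopfBilliard

/-! ### Metrics given in a global chart -/

/-- The partial derivative of `f` in the `i`-th coordinate direction. -/
def partialDeriv {d : ℕ} (i : Fin d) (f : EuclideanSpace ℝ (Fin d) → ℝ)
    (p : EuclideanSpace ℝ (Fin d)) : ℝ :=
  fderiv ℝ f p (EuclideanSpace.single i 1)

/-- The Christoffel symbol `Γ^k_{ij}` at `p` of the Levi-Civita connection of the metric with
coefficient matrix `G`. -/
def christoffel {d : ℕ} (G : EuclideanSpace ℝ (Fin d) → Matrix (Fin d) (Fin d) ℝ)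
    (k i j : Fin d) (p : EuclideanSpace ℝ (Fin d)) : ℝ :=
  (1 / 2) * ∑ l, (G p)⁻¹ k l *
    (partialDeriv i (fun q => G q j l) p + partialDeriv j (fun q => G q i l) p
      - partialDeriv l (fun q => G q i j) p)

/-! ### The upper half-space model of hyperbolic space of curvature `-1` -/

/-- The upper half-space model `{p | p₀ > 0}` of `(n+1)`-dimensional hyperbolic space. -/
def upperHalfSpace (n : ℕ) : Set (EuclideanSpace ℝ (Fin (n + 1))) := {p | 0 < p 0}

/-- The coefficients `δᵢⱼ / p₀²` of the hyperbolic metric. -/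
def hypMetric {n : ℕ} (p : EuclideanSpace ℝ (Fin (n + 1))) :
    Matrix (Fin (n + 1)) (Fin (n + 1)) ℝ :=
  fun i j => if i = j then 1 / (p 0) ^ 2 else 0

/-- The hyperbolic norm of a tangent vector `u` at `p`. -/
def hypNorm {n : ℕ} (p u : EuclideanSpace ℝ (Fin (n + 1))) : ℝ :=
  Real.sqrt (∑ i, ∑ j, hypMetric p i j * u i * u j)

/-- The hyperbolic length of a curve, parametrized by `[0, 1]`. -/
def hypLength {n : ℕ} (γ : ℝ → EuclideanSpace ℝ (Fin (n + 1))) : ℝ :=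
  ∫ t in (0 : ℝ)..1, hypNorm (γ t) (deriv γ t)

/-- The hyperbolic distance: the infimum of the lengths of `C¹` curves joining two points. -/
def hypDist {n : ℕ} (p q : EuclideanSpace ℝ (Fin (n + 1))) : ℝ :=
  sInf {ℓ : ℝ | ∃ γ : ℝ → EuclideanSpace ℝ (Fin (n + 1)), ContDiff ℝ 1 γ ∧
    (∀ t ∈ Icc (0 : ℝ) 1, γ t ∈ upperHalfSpace n) ∧ γ 0 = p ∧ γ 1 = q ∧ ℓ = hypLength γ}

/-- `γ : ℝ → H^{n+1}` is the (complete) geodesic `γ_u` with initial point `p` and initial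
velocity `u`: it stays in the half-space and solves the geodesic equation
`γₖ'' + ∑ Γ^k_{ij} γᵢ' γⱼ' = 0`. -/
structure IsGeodesicFrom {n : ℕ} (p u : EuclideanSpace ℝ (Fin (n + 1)))
    (γ : ℝ → EuclideanSpace ℝ (Fin (n + 1))) : Prop where
  smooth : ContDiff ℝ ∞ γ
  mem : ∀ t, γ t ∈ upperHalfSpace n
  geodesic_eq : ∀ t k, (deriv (deriv γ) t) k +
    ∑ i, ∑ j, christoffel hypMetric k i j (γ t) * (deriv γ t) i * (deriv γ t) j = 0
  init_point : γ 0 = p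
  init_velocity : deriv γ 0 = u

/-- The open geodesic ray `γ_u(0, ∞)`, for a tangent vector `u` at `p`. -/
def geodesicRay {n : ℕ} (p u : EuclideanSpace ℝ (Fin (n + 1))) :
    Set (EuclideanSpace ℝ (Fin (n + 1))) :=
  {q | ∃ γ, IsGeodesicFrom p u γ ∧ ∃ t : ℝ, 0 < t ∧ γ t = q}

/-- The vector `(a, x) ∈ ℝ^{n+1}` for `a ∈ ℝ` and `x ∈ ℝⁿ`. The map `x ↦ vcons 1 x` identifies
`ℝⁿ` with the horosphere `N = {p₀ = 1}`, and `vcons 0 w` is the tangent vector of `N` that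
corresponds to `w ∈ ℝⁿ`. -/
def vcons {n : ℕ} (a : ℝ) (x : EuclideanSpace ℝ (Fin n)) : EuclideanSpace ℝ (Fin (n + 1)) :=
  WithLp.toLp 2 (Fin.cons a x.ofLp : Fin (n + 1) → ℝ)

/-- The exterior `U = {0 < p₀ < 1}` of the horosphere `N = {p₀ = 1}`. -/
def exterior (n : ℕ) : Set (EuclideanSpace ℝ (Fin (n + 1))) := {p | 0 < p 0 ∧ p 0 < 1}

/-- `v` is a smooth unit vector field on the horosphere `N ≃ ℝⁿ`. -/
def IsSmoothUnitField {n : ℕ} (v : EuclideanSpace ℝ (Fin n) → EuclideanSpace ℝ (Fin n)) : Prop :=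
  ContDiff ℝ ∞ v ∧ ∀ x, hypNorm (vcons 1 x) (vcons 0 (v x)) = 1

/-! ### One-dimensional foliations -/

/-- `L` is a connected immersed smooth one-dimensional submanifold, i.e. the image of an injective
smooth immersion of a line or of a circle. -/
def IsImmersedCurve {n : ℕ} (L : Set (EuclideanSpace ℝ (Fin (n + 1)))) : Prop :=
  ∃ c : ℝ → EuclideanSpace ℝ (Fin (n + 1)), ContDiff ℝ ∞ c ∧ (∀ t, deriv c t ≠ 0) ∧ range c = L ∧
    (Injective c ∨ ∃ T > 0, Periodic c T ∧ InjOn c (Ico 0 T))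

/-- The sets in `F` are the leaves of a smooth one-dimensional foliation of the open set `W`:
they are connected immersed curves which partition `W`, and around each point of `W` there is a
smooth chart onto an open cube in `ℝ × ℝⁿ` (balls of this space are cubes) in which each leaf
is a countable union of slices `{y | y.2 = const}`. -/
structure IsSmoothFoliation {n : ℕ} (W : Set (EuclideanSpace ℝ (Fin (n + 1))))
    (F : Set (Set (EuclideanSpace ℝ (Fin (n + 1))))) : Prop where
  immersed : ∀ L ∈ F, IsImmersedCurve L
  disjoint : F.PairwiseDisjoint id
  cover : ⋃₀ F = W
  flat_chart : ∀ q ∈ W,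
    ∃ φ : OpenPartialHomeomorph (EuclideanSpace ℝ (Fin (n + 1))) (ℝ × (Fin n → ℝ)),
      q ∈ φ.source ∧ φ.source ⊆ W ∧
      ContDiffOn ℝ ∞ φ φ.source ∧ ContDiffOn ℝ ∞ φ.symm φ.target ∧
      (∃ c, ∃ ε > 0, φ.target = Metric.ball c ε) ∧
      ∀ L ∈ F, ∃ C : Set (Fin n → ℝ), C.Countable ∧
        φ '' (L ∩ φ.source) = {y | y ∈ φ.target ∧ y.2 ∈ C}

/-- The rays `γ_{v(p)}(0, ∞)`, `p ∈ N`, are the leaves of a smooth foliation of `U`. -/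
def ForwardFoliates {n : ℕ} (v : EuclideanSpace ℝ (Fin n) → EuclideanSpace ℝ (Fin n)) : Prop :=
  IsSmoothFoliation (exterior n) (range fun x => geodesicRay (vcons 1 x) (vcons 0 (v x)))

/-- The rays `γ_{-v(p)}(0, ∞)`, `p ∈ N`, are the leaves of a smooth foliation of `U`. -/
def BackwardFoliates {n : ℕ} (v : EuclideanSpace ℝ (Fin n) → EuclideanSpace ℝ (Fin n)) : Prop :=
  IsSmoothFoliation (exterior n) (range fun x => geodesicRay (vcons 1 x) (vcons 0 (-v x)))

/-- `v` bifoliates the exterior of the horosphere. -/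
def Bifoliates {n : ℕ} (v : EuclideanSpace ℝ (Fin n) → EuclideanSpace ℝ (Fin n)) : Prop :=
  ForwardFoliates v ∧ BackwardFoliates v

/-- `B` is an invertible outer billiard map of `v`: for `p ∈ N` and `t > 0`, the points
`γ_{v(p)}(±t)` lie in `U` and `B (γ_{v(p)}(-t)) = γ_{v(p)}(t)`. -/
def IsOuterBilliardMap {n : ℕ} (v : EuclideanSpace ℝ (Fin n) → EuclideanSpace ℝ (Fin n))
    (B : Equiv.Perm (exterior n)) : Prop :=
  ∀ x γ, IsGeodesicFrom (vcons 1 x) (vcons 0 (v x)) γ → ∀ t : ℝ, 0 < t →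
    ∃ q : exterior n, (q : EuclideanSpace ℝ (Fin (n + 1))) = γ (-t) ∧
      (B q : EuclideanSpace ℝ (Fin (n + 1))) = γ t

/-! ### The Hopf-like field on `ℝ³` -/

/-- The Hopf vector field `V(t, x, y, z) = (-x, t, -z, y)`. -/
def hopfField (q : EuclideanSpace ℝ (Fin 4)) : EuclideanSpace ℝ (Fin 4) :=
  !₂[-q 1, q 0, -q 3, q 2]

/-- The stereographic projection `(t, x, y, z) ↦ (x, y, z) / (1 - t)`, extended by the same formula
to the open set `t ≠ 1` of the ambient space. -/
def stereo (q : EuclideanSpace ℝ (Fin 4)) : EuclideanSpace ℝ (Fin 3) :=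
  (1 / (1 - q 0)) • !₂[q 1, q 2, q 3]

/-- The unit vector field
`v(x,y,z) = (x² - y² - z² + 1, 2xy + 2z, 2xz - 2y) / (x² + y² + z² + 1)`. -/
def hopfLike (p : EuclideanSpace ℝ (Fin 3)) : EuclideanSpace ℝ (Fin 3) :=
  (1 / ((p 0) ^ 2 + (p 1) ^ 2 + (p 2) ^ 2 + 1)) •
    !₂[(p 0) ^ 2 - (p 1) ^ 2 - (p 2) ^ 2 + 1, 2 * p 0 * p 1 + 2 * p 2, 2 * p 0 * p 2 - 2 * p 1]

/-- The circle `C_h = {(h, x, y, z) | x = 0, y² + z² = 2 - h²}` in `U`. -/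
def circleC (h : ℝ) : Set (exterior 3) :=
  {q | q.1 0 = h ∧ q.1 1 = 0 ∧ (q.1 2) ^ 2 + (q.1 3) ^ 2 = 2 - h ^ 2}

/-- The rotation angle `θ_h = 2 arctan √(1 - h²)`. -/
def rotAngle (h : ℝ) : ℝ := 2 * Real.arctan (Real.sqrt (1 - h ^ 2))

end HopfBilliard

end

noncomputable section

namespace HopfBilliard

variable {n : ℕ}

/-! ### Coordinates -/

/-! The unit-speed geodesic tangent to `N` at `(1, x)` in a unit direction `w` is the half circle of
Euclidean radius 1 about `(0, x)`, namely `t ↦ (1 / cosh t, x + tanh t • w)`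
(`IsGeodesicFrom.eq_halfCircle`). With `s = √(1 - h²)`, it meets height `h < 1` exactly at the
points over `x ± s • w`. The hyperbolic statements thus become statements about the shears `x ↦ x +
s • v x` of `ℝⁿ`. If all shears have inverses `ψ s` depending smoothly on `s`, then `q ↦ (q 0, ψ
(reach (q 0)) (vtail q))` straightens the rays, and at height `h` the billiard map is the shear by
`s` composed with the inverse of the shear by `-s`.

For the Hopf-like field, write `x = (b, w₀)` with `w₀ ∈ ℂ`, and `D = b² + |w₀|² + 1`. Then `v x =
((b² + 1 - |w₀|²) / D, 2 w₀ (b - i) / D)`. If `(a, w) = x + s • v x` and `μ = 1 + 2s (b - i) / D`,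
then `w = μ w₀` and `a + s + i = μ (b + i)`. The ratio `w₀ / (b + i)` is therefore preserved. Its
modulus determines the first component of `v x`, hence `b`, hence `w₀`, which gives the explicit
inverse `hopfShearInverse`.

The orbits come from two invariant curves of the field: it is constant along the `x`-axis, and
tangent to the unit circle in the plane `x = 0`. Unboundedness holds because hyperbolic length
dominates the variation of `log ‖p‖`. -/

@[simp] theorem vcons_apply_zero (a : ℝ) (x : EuclideanSpace ℝ (Fin n)) : vcons a x 0 = a := rfl

@[simp] theorem vcons_apply_succ (a : ℝ) (x : EuclideanSpace ℝ (Fin n)) (i : Fin n) :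
    vcons a x i.succ = x i := rfl

/-- The last `n` coordinates of a vector of `ℝ^{n+1}`. -/
def vtail (p : EuclideanSpace ℝ (Fin (n + 1))) : EuclideanSpace ℝ (Fin n) :=
  WithLp.toLp 2 fun i => p i.succ

@[simp] theorem vtail_apply (p : EuclideanSpace ℝ (Fin (n + 1))) (i : Fin n) :
    vtail p i = p i.succ := rfl

@[simp] theorem vtail_vcons (a : ℝ) (x : EuclideanSpace ℝ (Fin n)) : vtail (vcons a x) = x := rfl

@[simp] theorem vcons_vtail (p : EuclideanSpace ℝ (Fin (n + 1))) : vcons (p 0) (vtail p) = p := by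
  ext i
  refine Fin.cases ?_ (fun i => ?_) i <;> simp

theorem vcons_injective {a b : ℝ} {x y : EuclideanSpace ℝ (Fin n)} (h : vcons a x = vcons b y) :
    a = b ∧ x = y :=
  ⟨congrArg (fun p => p 0) h, congrArg vtail h⟩

theorem norm_vcons_zero (x : EuclideanSpace ℝ (Fin n)) : ‖vcons 0 x‖ = ‖x‖ := by
  simp [EuclideanSpace.norm_eq, Fin.sum_univ_succ]

theorem contDiffOn_vcons {E : Type*} [NormedAddCommGroup E] [NormedSpace ℝ E] {s : Set E}
    {f : E → ℝ} {g : E → EuclideanSpace ℝ (Fin n)} {m : WithTop ℕ∞} (hf : ContDiffOn ℝ m f s)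
    (hg : ContDiffOn ℝ m g s) : ContDiffOn ℝ m (fun z => vcons (f z) (g z)) s := by
  rw [contDiffOn_euclidean] at hg ⊢
  exact Fin.cases hf hg

theorem contDiff_vtail {m : WithTop ℕ∞} : ContDiff ℝ m (vtail (n := n)) := by
  rw [contDiff_euclidean]
  intro i
  simp only [vtail_apply]
  fun_prop

/-! ### The hyperbolic metric -/

theorem hypNorm_eq {p u : EuclideanSpace ℝ (Fin (n + 1))} (hp : 0 < p 0) :
    hypNorm p u = ‖u‖ / p 0 := by
  have : ∑ i, ∑ j, hypMetric p i j * u i * u j = (‖u‖ / p 0) ^ 2 := by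
    rw [div_pow, EuclideanSpace.real_norm_sq_eq, Finset.sum_div]
    refine Finset.sum_congr rfl fun i _ => ?_
    simp only [hypMetric, ite_mul, zero_mul, Finset.sum_ite_eq, Finset.mem_univ, if_true]
    ring
  rw [hypNorm, this, Real.sqrt_sq (by positivity)]

theorem partialDeriv_hypMetric (i j k : Fin (n + 1)) {p : EuclideanSpace ℝ (Fin (n + 1))}
    (hp : 0 < p 0) :
    partialDeriv i (fun q => hypMetric q j k) p =
      (if i = 0 then 1 else 0) * (if j = k then 1 else 0) * (-2 / p 0 ^ 3) := by
  unfold partialDeriv hypMetric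
  by_cases h : j = k
  · have h0 : HasFDerivAt (fun q : EuclideanSpace ℝ (Fin (n + 1)) => q 0)
        (EuclideanSpace.proj (𝕜 := ℝ) (0 : Fin (n + 1))) p :=
      (EuclideanSpace.proj (𝕜 := ℝ) (0 : Fin (n + 1))).hasFDerivAt
    have h1 : HasDerivAt (fun r : ℝ => 1 / r ^ 2) (-2 / p 0 ^ 3) (p 0) := by
      have := (hasDerivAt_pow 2 (p 0)).inv (pow_ne_zero 2 hp.ne')
      simp only [one_div]
      refine this.congr_deriv ?_
      field_simp
      norm_num
      ring
    have h2 := h1.comp_hasFDerivAt p h0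
    simp only [h, if_true]
    rw [show (fun q : EuclideanSpace ℝ (Fin (n + 1)) => 1 / q 0 ^ 2) =
      (fun r : ℝ => 1 / r ^ 2) ∘ fun q : EuclideanSpace ℝ (Fin (n + 1)) => q 0 from rfl, h2.fderiv]
    simp [eq_comm (a := (0 : Fin (n + 1)))]
  · simp [h]

theorem hypMetric_inv {p : EuclideanSpace ℝ (Fin (n + 1))} (hp : 0 < p 0) :
    (hypMetric p)⁻¹ = Matrix.diagonal fun _ => p 0 ^ 2 := by
  apply Matrix.inv_eq_right_inv
  have : hypMetric p = Matrix.diagonal fun _ => 1 / p 0 ^ 2 := by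
    ext i j
    simp [hypMetric, Matrix.diagonal_apply]
  rw [this, Matrix.diagonal_mul_diagonal, ← Matrix.diagonal_one]
  congr 1
  ext
  field_simp

theorem christoffel_hypMetric (k i j : Fin (n + 1)) {p : EuclideanSpace ℝ (Fin (n + 1))}
    (hp : 0 < p 0) :
    christoffel hypMetric k i j p = -(1 / p 0) *
      ((if i = 0 then 1 else 0) * (if j = k then 1 else 0) +
        (if j = 0 then 1 else 0) * (if i = k then 1 else 0) -
        (if k = 0 then 1 else 0) * (if i = j then 1 else 0)) := by
  unfold christoffel
  simp only [hypMetric_inv hp, partialDeriv_hypMetric _ _ _ hp]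
  rw [Finset.sum_eq_single k (fun l _ hl => by rw [Matrix.diagonal_apply_ne' _ hl, zero_mul])
    (by simp), Matrix.diagonal_apply_eq]
  have h : p 0 ^ 2 * (-2 / p 0 ^ 3) = -2 * (1 / p 0) := by field_simp
  linear_combination (1 / 2) * ((if i = 0 then 1 else 0) * (if j = k then 1 else 0) +
    (if j = 0 then 1 else 0) * (if i = k then 1 else 0) -
    (if k = 0 then 1 else 0) * (if i = j then 1 else 0)) * h

theorem sum_christoffel_hypMetric (k : Fin (n + 1)) {p : EuclideanSpace ℝ (Fin (n + 1))}
    (u : EuclideanSpace ℝ (Fin (n + 1))) (hp : 0 < p 0) :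
    ∑ i, ∑ j, christoffel hypMetric k i j p * u i * u j =
      -(1 / p 0) * (2 * u 0 * u k - (if k = 0 then 1 else 0) * ‖u‖ ^ 2) := by
  simp only [christoffel_hypMetric _ _ _ hp, EuclideanSpace.real_norm_sq_eq]
  have h1 : ∑ i, ∑ j, (if i = 0 then 1 else 0) * (if j = k then 1 else 0) * (u i * u j) =
      u 0 * u k := by simp [ite_mul]
  have h2 : ∑ i, ∑ j, (if j = 0 then 1 else 0) * (if i = k then 1 else 0) * (u i * u j) =
      u k * u 0 := by simp [ite_mul]
  have h3 : ∑ i, ∑ j, (if k = 0 then 1 else 0) * (if i = j then 1 else 0) * (u i * u j) =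
      (if k = 0 then 1 else 0) * ∑ i, u i ^ 2 := by
    rw [Finset.mul_sum]
    refine Finset.sum_congr rfl fun i _ => ?_
    simp [Finset.sum_ite_eq, ite_mul, sq]
  rw [show 2 * u 0 * u k = u 0 * u k + u k * u 0 by ring, ← h1, ← h2, ← h3,
    ← Finset.sum_add_distrib, ← Finset.sum_sub_distrib, Finset.mul_sum]
  refine Finset.sum_congr rfl fun i _ => ?_
  rw [← Finset.sum_add_distrib, ← Finset.sum_sub_distrib, Finset.mul_sum]
  refine Finset.sum_congr rfl fun j _ => ?_
  ring

/-- Every curve from `p` to `q` has length at least `log ‖q‖ - log ‖p‖`. -/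
theorem log_norm_sub_log_norm_le_hypLength {γ : ℝ → EuclideanSpace ℝ (Fin (n + 1))}
    (hγ : ContDiff ℝ 1 γ) (hU : ∀ t ∈ Icc (0 : ℝ) 1, γ t ∈ upperHalfSpace n) :
    Real.log ‖γ 1‖ - Real.log ‖γ 0‖ ≤ hypLength γ := by
  have hd := hγ.continuous_deriv le_rfl
  have hc := hγ.continuous
  have hpos : ∀ t ∈ Icc (0 : ℝ) 1, 0 < γ t 0 := hU
  have hne : ∀ t ∈ Icc (0 : ℝ) 1, γ t ≠ 0 := fun t ht h => by
    have := hpos t ht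
    simp [h] at this
  have hcont : ContinuousOn (fun t => ‖deriv γ t‖ / γ t 0) (Icc 0 1) := by
    refine ContinuousOn.div (by fun_prop) (by fun_prop) fun t ht => (hpos t ht).ne'
  have hint : hypLength γ = ∫ t in (0 : ℝ)..1, ‖deriv γ t‖ / γ t 0 := by
    refine intervalIntegral.integral_congr fun t ht => ?_
    rw [uIcc_of_le zero_le_one] at ht
    exact hypNorm_eq (hpos t ht)
  rw [hint]
  have hder : ∀ t ∈ Ioo (0 : ℝ) 1, HasDerivAt (fun t => Real.log ‖γ t‖)
      (inner ℝ (γ t) (deriv γ t) / ‖γ t‖ ^ 2) t := by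
    intro t ht
    have ht' := Ioo_subset_Icc_self ht
    have h1 : HasDerivAt γ (deriv γ t) t := (hγ.differentiable one_ne_zero t).hasDerivAt
    have h2 := (h1.norm_sq.log (by simpa using hne t ht')).const_mul (1 / 2)
    -- `log ‖γ‖` is treated as half of `log ‖γ‖²`.
    refine (h2.congr_deriv ?_).congr_of_eventuallyEq (.of_forall fun s => ?_)
    · ring
    · simp [Real.log_pow]
  refine intervalIntegral.sub_le_integral_of_hasDeriv_right_of_le zero_le_one ?_
    (fun t ht => (hder t ht).hasDerivWithinAt) (hcont.integrableOn_Icc) ?_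
  · exact ContinuousOn.log (by fun_prop) fun t ht => norm_ne_zero_iff.2 (hne t ht)
  · intro t ht
    have ht' := Ioo_subset_Icc_self ht
    have h0 := hpos t ht'
    have hn : 0 < ‖γ t‖ := norm_pos_iff.2 (hne t ht')
    -- The height is at most the Euclidean norm, so the hyperbolic speed dominates the derivative of
    -- `log ‖γ‖`.
    have hle : γ t 0 ≤ ‖γ t‖ := (le_abs_self _).trans (PiLp.norm_apply_le (γ t) 0)
    calc inner ℝ (γ t) (deriv γ t) / ‖γ t‖ ^ 2 ≤ ‖γ t‖ * ‖deriv γ t‖ / ‖γ t‖ ^ 2 := by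
          gcongr
          exact real_inner_le_norm _ _
      _ = ‖deriv γ t‖ / ‖γ t‖ := by field_simp
      _ ≤ ‖deriv γ t‖ / γ t 0 := by gcongr

theorem log_norm_sub_log_norm_le_hypDist {p q : EuclideanSpace ℝ (Fin (n + 1))}
    (hp : p ∈ upperHalfSpace n) (hq : q ∈ upperHalfSpace n) :
    Real.log ‖q‖ - Real.log ‖p‖ ≤ hypDist p q := by
  -- The bound on the infimum needs at least one competitor: the straight segment, which stays in
  -- the convex half-space.
  refine le_csInf ⟨_, fun t => p + t • (q - p), by fun_prop, fun t ht => ?_, by simp, by simp, rfl⟩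
    ?_
  · have hp' : 0 < p 0 := hp
    have hq' : 0 < q 0 := hq
    show 0 < p 0 + t * (q 0 - p 0)
    obtain ⟨h0, h1⟩ := ht
    rcases h0.eq_or_lt with rfl | h0
    · simpa using hp'
    · nlinarith [mul_pos h0 hq', mul_nonneg (sub_nonneg.2 h1) hp'.le]
  · rintro _ ⟨γ, hγ, hU, rfl, rfl, rfl⟩
    exact log_norm_sub_log_norm_le_hypLength hγ hU

/-! ### Geodesics tangent to the horosphere -/

/-- The geodesic equation of the upper half-space in vector form. -/
theorem geodesic_eq_iff {p u a : EuclideanSpace ℝ (Fin (n + 1))} (hp : 0 < p 0) :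
    (∀ k, a k + ∑ i, ∑ j, christoffel hypMetric k i j p * u i * u j = 0) ↔
      p 0 • a = (2 * u 0) • u - ‖u‖ ^ 2 • EuclideanSpace.single 0 1 := by
  rw [PiLp.ext_iff]
  refine forall_congr' fun k => ?_
  rw [sum_christoffel_hypMetric k u hp]
  simp only [PiLp.smul_apply, PiLp.sub_apply, smul_eq_mul, PiLp.single_apply]
  field_simp
  constructor <;> intro h <;> linarith

/-- The half circle over `x` in the direction `w`, parametrized by arc length if `‖w‖ = 1`. -/
def halfCircle (x w : EuclideanSpace ℝ (Fin n)) (t : ℝ) : EuclideanSpace ℝ (Fin (n + 1)) :=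
  vcons (Real.cosh t)⁻¹ (x + (Real.sinh t / Real.cosh t) • w)

theorem contDiff_halfCircle (x w : EuclideanSpace ℝ (Fin n)) : ContDiff ℝ ∞ (halfCircle x w) := by
  have h := Real.contDiff_cosh (n := ∞)
  have h' := Real.contDiff_sinh (n := ∞)
  have h0 := fun t => (Real.cosh_pos t).ne'
  rw [← contDiffOn_univ]
  refine contDiffOn_vcons (h.inv h0).contDiffOn (ContDiff.contDiffOn ?_)
  exact contDiff_const.add ((h'.div h h0).smul contDiff_const)

theorem hasDerivAt_inv_cosh (t : ℝ) :
    HasDerivAt (fun t => (Real.cosh t)⁻¹) (-Real.sinh t / Real.cosh t ^ 2) t :=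
  (Real.hasDerivAt_cosh t).inv (Real.cosh_pos t).ne'

theorem hasDerivAt_sinh_div_cosh (t : ℝ) :
    HasDerivAt (fun t => Real.sinh t / Real.cosh t) (1 / Real.cosh t ^ 2) t := by
  refine ((Real.hasDerivAt_sinh t).div (Real.hasDerivAt_cosh t) (Real.cosh_pos t).ne').congr_deriv ?_
  rw [← Real.cosh_sq_sub_sinh_sq t]
  ring

theorem hasDerivAt_euclidean {g : ℝ → EuclideanSpace ℝ (Fin n)} {g' : EuclideanSpace ℝ (Fin n)}
    {t : ℝ} : HasDerivAt g g' t ↔ ∀ i, HasDerivAt (fun s => g s i) (g' i) t := by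
  simp only [hasDerivAt_iff_hasFDerivAt, ← hasFDerivWithinAt_univ, hasFDerivWithinAt_euclidean]
  refine forall_congr' fun i => iff_of_eq ?_
  congr 1

theorem hasDerivAt_vcons {f : ℝ → ℝ} {g : ℝ → EuclideanSpace ℝ (Fin n)} {f' t : ℝ}
    {g' : EuclideanSpace ℝ (Fin n)} (hf : HasDerivAt f f' t) (hg : HasDerivAt g g' t) :
    HasDerivAt (fun s => vcons (f s) (g s)) (vcons f' g') t := by
  rw [hasDerivAt_euclidean] at hg ⊢
  exact Fin.cases hf hg

theorem deriv_halfCircle (x w : EuclideanSpace ℝ (Fin n)) (t : ℝ) : deriv (halfCircle x w) t =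
    vcons (-Real.sinh t / Real.cosh t ^ 2) ((1 / Real.cosh t ^ 2) • w) :=
  (hasDerivAt_vcons (hasDerivAt_inv_cosh t)
    (((hasDerivAt_sinh_div_cosh t).smul_const w).const_add x)).deriv

theorem norm_sq_vcons (a : ℝ) (x : EuclideanSpace ℝ (Fin n)) :
    ‖vcons a x‖ ^ 2 = a ^ 2 + ‖x‖ ^ 2 := by
  simp [EuclideanSpace.real_norm_sq_eq, Fin.sum_univ_succ]

theorem isGeodesicFrom_halfCircle (x : EuclideanSpace ℝ (Fin n)) {w : EuclideanSpace ℝ (Fin n)}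
    (hw : ‖w‖ = 1) : IsGeodesicFrom (vcons 1 x) (vcons 0 w) (halfCircle x w) where
  smooth := contDiff_halfCircle x w
  mem t := inv_pos.2 (Real.cosh_pos t)
  init_point := by simp [halfCircle]
  init_velocity := by simp [deriv_halfCircle]
  geodesic_eq t := by
    rw [geodesic_eq_iff (inv_pos.2 (Real.cosh_pos t) : 0 < halfCircle x w t 0)]
    have hc := (Real.cosh_pos t).ne'
    have h1 : HasDerivAt (fun t => -Real.sinh t / Real.cosh t ^ 2)
        ((Real.sinh t ^ 2 - 1) / Real.cosh t ^ 3) t := by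
      refine ((Real.hasDerivAt_sinh t).neg.div ((Real.hasDerivAt_cosh t).pow 2)
        (pow_ne_zero 2 hc)).congr_deriv ?_
      simp only [Pi.neg_apply, Pi.pow_apply]
      field_simp
      push_cast
      linear_combination -Real.cosh t * Real.cosh_sq t
    have h2 : HasDerivAt (fun t => 1 / Real.cosh t ^ 2) (-2 * Real.sinh t / Real.cosh t ^ 3) t := by
      refine ((hasDerivAt_const t (1 : ℝ)).div ((Real.hasDerivAt_cosh t).pow 2)
        (pow_ne_zero 2 hc)).congr_deriv ?_
      simp only [Pi.pow_apply]
      field_simp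
      push_cast
      ring
    have hd : deriv (deriv (halfCircle x w)) t = vcons ((Real.sinh t ^ 2 - 1) / Real.cosh t ^ 3)
        ((-2 * Real.sinh t / Real.cosh t ^ 3) • w) := by
      rw [funext (deriv_halfCircle x w)]
      exact (hasDerivAt_vcons h1 (h2.smul_const w)).deriv
    rw [hd, deriv_halfCircle, norm_sq_vcons, norm_smul, hw]
    ext k
    refine Fin.cases ?_ (fun k => ?_) k
    · simp [halfCircle]
      field_simp
      ring
    · simp [halfCircle]
      field_simp

theorem eq_of_hasDerivAt_zero {f : ℝ → ℝ} (hf : ∀ t, HasDerivAt f 0 t) (t : ℝ) : f t = f 0 :=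
  is_const_of_deriv_eq_zero (fun s => (hf s).differentiableAt) (fun s => (hf s).deriv) t 0

/-- The system decouples: `f + g` grows like `exp t` and `f - g` decays like `exp (-t)`. -/
theorem eq_cosh_of_hasDerivAt {f g : ℝ → ℝ} (hf : ∀ t, HasDerivAt f (g t) t)
    (hg : ∀ t, HasDerivAt g (f t) t) (hf0 : f 0 = 1) (hg0 : g 0 = 0) (t : ℝ) :
    f t = Real.cosh t := by
  have h1 := eq_of_hasDerivAt_zero (f := fun t => Real.exp (-t) * (f t + g t)) (fun t =>
    (((hasDerivAt_neg t).exp.mul ((hf t).add (hg t))).congr_deriv (by simp; ring))) t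
  have h2 := eq_of_hasDerivAt_zero (f := fun t => Real.exp t * (f t - g t)) (fun t =>
    (((Real.hasDerivAt_exp t).mul ((hf t).sub (hg t))).congr_deriv (by simp; ring))) t
  simp only [hf0, hg0, neg_zero, Real.exp_zero] at h1 h2
  have h3 : Real.exp t * Real.exp (-t) = 1 := by rw [← Real.exp_add]; simp
  rw [Real.cosh_eq]
  linear_combination (Real.exp t * h1 + Real.exp (-t) * h2) / 2 - f t * h3

/-- First integrals replace an ODE uniqueness theorem: conservation of speed makes `1 / γ₀` solve
`u'' = u`, and the horizontal translations, being isometries, make each `γₖ' / γ₀²` constant. -/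
theorem IsGeodesicFrom.eq_halfCircle {x w : EuclideanSpace ℝ (Fin n)} (hw : ‖w‖ = 1)
    {γ : ℝ → EuclideanSpace ℝ (Fin (n + 1))} (h : IsGeodesicFrom (vcons 1 x) (vcons 0 w) γ) :
    γ = halfCircle x w := by
  have hpos : ∀ t, 0 < γ t 0 := h.mem
  have hd1 : ∀ t, HasDerivAt γ (deriv γ t) t := fun t =>
    (h.smooth.differentiable (by simp) t).hasDerivAt
  have hd2 : ∀ t, HasDerivAt (deriv γ) (deriv (deriv γ) t) t := fun t => by
    have : ContDiff ℝ ∞ (deriv γ) := (contDiff_infty_iff_deriv.1 h.smooth).2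
    exact (this.differentiable (by simp) t).hasDerivAt
  have hc1 : ∀ k t, HasDerivAt (fun t => γ t k) (deriv γ t k) t := fun k t =>
    hasDerivAt_euclidean.1 (hd1 t) k
  have hc2 : ∀ k t, HasDerivAt (fun t => deriv γ t k) (deriv (deriv γ) t k) t := fun k t =>
    hasDerivAt_euclidean.1 (hd2 t) k
  have heq := fun t => (geodesic_eq_iff (hpos t)).1 (h.geodesic_eq t)
  have heq' : ∀ t k, γ t 0 * deriv (deriv γ) t k =
      2 * deriv γ t 0 * deriv γ t k - ‖deriv γ t‖ ^ 2 * if k = 0 then 1 else 0 := fun t k => by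
    simpa [PiLp.single_apply] using congrArg (fun p => p k) (heq t)
  have hE : ∀ t, ‖deriv γ t‖ ^ 2 = γ t 0 ^ 2 := by
    intro t
    have key := eq_of_hasDerivAt_zero (f := fun t => ‖deriv γ t‖ ^ 2 / γ t 0 ^ 2) (fun t => by
      have hne := (hpos t).ne'
      refine ((hd2 t).norm_sq.div ((hc1 0 t).pow 2) (pow_ne_zero 2 hne)).congr_deriv ?_
      have hin := congrArg (fun a => inner ℝ (deriv γ t) a) (heq t)
      simp only [inner_smul_right, inner_sub_right, real_inner_self_eq_norm_sq,
        EuclideanSpace.inner_single_right] at hin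
      simp only [one_mul, conj_trivial] at hin
      have : inner ℝ (deriv γ t) (deriv (deriv γ) t) =
          deriv γ t 0 * ‖deriv γ t‖ ^ 2 / γ t 0 := by
        field_simp
        linarith
      simp only [Pi.pow_apply, this]
      field_simp
      push_cast
      ring) t
    have hne := (hpos t).ne'
    simp only [h.init_velocity, h.init_point, norm_vcons_zero, hw, vcons_apply_zero] at key
    field_simp at key
    linarith
  have hu : ∀ t, (γ t 0)⁻¹ = Real.cosh t := by
    refine eq_cosh_of_hasDerivAt (g := fun t => -deriv γ t 0 / γ t 0 ^ 2)
      (fun t => (hc1 0 t).inv (hpos t).ne') (fun t => ?_) (by simp [h.init_point])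
      (by simp [h.init_velocity])
    have hne := (hpos t).ne'
    refine ((hc2 0 t).neg.div ((hc1 0 t).pow 2) (pow_ne_zero 2 hne)).congr_deriv ?_
    have h0 := heq' t 0
    rw [hE] at h0
    have h0' : deriv (deriv γ) t 0 = (2 * deriv γ t 0 * deriv γ t 0 - γ t 0 ^ 2) / γ t 0 := by
      field_simp
      simp only [if_true, mul_one] at h0
      linarith
    simp only [Pi.pow_apply, Pi.neg_apply, h0']
    field_simp
    push_cast
    ring
  have ha : ∀ t, γ t 0 = (Real.cosh t)⁻¹ := fun t => by rw [← hu, inv_inv]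
  have hb : ∀ k : Fin n, ∀ t, deriv γ t k.succ = (1 / Real.cosh t ^ 2) * w k := by
    intro k t
    have key := eq_of_hasDerivAt_zero (f := fun t => deriv γ t k.succ / γ t 0 ^ 2) (fun t => by
      have hne := (hpos t).ne'
      refine ((hc2 k.succ t).div ((hc1 0 t).pow 2) (pow_ne_zero 2 hne)).congr_deriv ?_
      have h0 := heq' t k.succ
      simp only [Fin.succ_ne_zero, if_false, mul_zero, sub_zero] at h0
      have h0' : deriv (deriv γ) t k.succ = (2 * deriv γ t 0 * deriv γ t k.succ) / γ t 0 := by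
        field_simp
        linarith
      simp only [Pi.pow_apply, h0']
      field_simp
      push_cast
      ring) t
    simp only [h.init_velocity, h.init_point, vcons_apply_zero, vcons_apply_succ, ha] at key
    have := (Real.cosh_pos t).ne'
    field_simp at key ⊢
    linarith
  funext t
  ext k
  refine Fin.cases (ha t) (fun k => ?_) k
  have key := eq_of_hasDerivAt_zero
    (f := fun t => γ t k.succ - Real.sinh t / Real.cosh t * w k) (fun t => by
      refine ((hc1 k.succ t).sub ((hasDerivAt_sinh_div_cosh t).mul_const (w k))).congr_deriv ?_
      rw [hb, sub_self]) t
  simp only [h.init_point, vcons_apply_succ, Real.sinh_zero, zero_div, zero_mul, sub_zero] at key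
  simp [halfCircle, ← key]

/-! ### Tangent rays -/

/-- The Euclidean distance `√(1 - h²)` between the foot of a half circle of radius `1` and the
projection of its point at height `h`. -/
def reach (h : ℝ) : ℝ := Real.sqrt (1 - h ^ 2)

theorem reach_inv_cosh {t : ℝ} (ht : 0 < t) :
    reach (Real.cosh t)⁻¹ = Real.sinh t / Real.cosh t := by
  have hc := Real.cosh_pos t
  have hs := Real.sinh_pos_iff.2 ht
  rw [reach, ← Real.sqrt_sq (div_nonneg hs.le hc.le)]
  congr 1
  field_simp
  linarith [Real.cosh_sq t]

theorem exists_inv_cosh_eq {h : ℝ} (h0 : 0 < h) (h1 : h < 1) :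
    ∃ t > 0, (Real.cosh t)⁻¹ = h := by
  have hs : 0 < 1 - h ^ 2 := by nlinarith
  refine ⟨Real.arsinh (Real.sqrt (1 - h ^ 2) / h), Real.arsinh_pos_iff.2 (by positivity), ?_⟩
  rw [Real.cosh_arsinh, div_pow, Real.sq_sqrt hs.le, inv_eq_iff_eq_inv, ← Real.sqrt_sq
    (inv_pos.2 h0).le]
  congr 1
  field_simp
  ring

theorem inv_cosh_lt_one {t : ℝ} (ht : 0 < t) : (Real.cosh t)⁻¹ < 1 :=
  inv_lt_one_of_one_lt₀ (Real.one_lt_cosh.2 ht.ne')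

theorem halfCircle_of_pos (x w : EuclideanSpace ℝ (Fin n)) {t : ℝ} (ht : 0 < t) :
    halfCircle x w t = vcons (Real.cosh t)⁻¹ (x + reach (Real.cosh t)⁻¹ • w) := by
  rw [reach_inv_cosh ht, halfCircle]

theorem halfCircle_neg (x w : EuclideanSpace ℝ (Fin n)) (t : ℝ) :
    halfCircle x w (-t) = halfCircle x (-w) t := by
  simp [halfCircle, neg_div]

theorem geodesicRay_eq_image (x : EuclideanSpace ℝ (Fin n)) {w : EuclideanSpace ℝ (Fin n)}
    (hw : ‖w‖ = 1) : geodesicRay (vcons 1 x) (vcons 0 w) = halfCircle x w '' Ioi 0 := by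
  ext q
  constructor
  · rintro ⟨γ, hγ, t, ht, rfl⟩
    exact ⟨t, ht, by rw [hγ.eq_halfCircle hw]⟩
  · rintro ⟨t, ht, rfl⟩
    exact ⟨_, isGeodesicFrom_halfCircle x hw, t, ht, rfl⟩

/-- The height decreases strictly from 1 to 0 along the ray, so the ray is a graph over the height.
-/
theorem mem_geodesicRay_iff {x : EuclideanSpace ℝ (Fin n)} {w : EuclideanSpace ℝ (Fin n)}
    (hw : ‖w‖ = 1) {q : EuclideanSpace ℝ (Fin (n + 1))} :
    q ∈ geodesicRay (vcons 1 x) (vcons 0 w) ↔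
      q ∈ exterior n ∧ x + reach (q 0) • w = vtail q := by
  rw [geodesicRay_eq_image x hw]
  constructor
  · rintro ⟨t, ht, rfl⟩
    rw [halfCircle_of_pos x w ht]
    exact ⟨⟨inv_pos.2 (Real.cosh_pos t), inv_cosh_lt_one ht⟩, rfl⟩
  · rintro ⟨⟨h0, h1⟩, hq⟩
    obtain ⟨t, ht, hth⟩ := exists_inv_cosh_eq h0 h1
    exact ⟨t, ht, by rw [halfCircle_of_pos x w ht, hth, hq, vcons_vtail]⟩

theorem isImmersedCurve_geodesicRay (x : EuclideanSpace ℝ (Fin n))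
    {w : EuclideanSpace ℝ (Fin n)} (hw : ‖w‖ = 1) :
    IsImmersedCurve (geodesicRay (vcons 1 x) (vcons 0 w)) := by
  -- `exp` reparametrizes the open ray by all of `ℝ`; the height alone already has nonzero
  -- derivative.
  refine ⟨halfCircle x w ∘ Real.exp, (contDiff_halfCircle x w).comp Real.contDiff_exp,
    fun t ht => ?_, ?_, Or.inl fun s t hst => ?_⟩
  · have h1 := ((contDiff_halfCircle x w).differentiable (by simp) (Real.exp t)).hasDerivAt
    rw [(h1.scomp t (Real.hasDerivAt_exp t)).deriv, smul_eq_zero, or_iff_right (Real.exp_pos t).ne',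
      deriv_halfCircle] at ht
    have h2 := congrArg (fun p => p 0) ht
    simp only [vcons_apply_zero, PiLp.zero_apply, div_eq_zero_iff, neg_eq_zero, pow_eq_zero_iff,
      ne_eq, OfNat.ofNat_ne_zero, not_false_eq_true, (Real.cosh_pos _).ne', or_false,
      Real.sinh_eq_zero] at h2
    exact (Real.exp_pos t).ne' h2
  · rw [range_comp, Real.range_exp, geodesicRay_eq_image x hw]
  · have h := inv_injective (vcons_injective hst).1
    exact Real.exp_injective
      (Real.cosh_strictMonoOn.injOn (Real.exp_pos s).le (Real.exp_pos t).le h)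

theorem contDiffOn_reach : ContDiffOn ℝ ∞ reach (Ioo 0 1) := by
  refine ContDiffOn.sqrt (by fun_prop) fun h hh => ?_
  have := hh.1
  have := hh.2
  nlinarith

/-! ### Fields all of whose shears are invertible -/

/-- `ψ s` is the inverse of `x ↦ x + s • v x`, for all `s`, and depends smoothly on `s`. -/
structure IsShearInverse (v : EuclideanSpace ℝ (Fin n) → EuclideanSpace ℝ (Fin n))
    (ψ : ℝ → EuclideanSpace ℝ (Fin n) → EuclideanSpace ℝ (Fin n)) : Prop where
  smooth : ContDiff ℝ ∞ (uncurry ψ)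
  left_inv : ∀ s x, ψ s (x + s • v x) = x
  right_inv : ∀ s y, ψ s y + s • v (ψ s y) = y

theorem IsShearInverse.neg {v : EuclideanSpace ℝ (Fin n) → EuclideanSpace ℝ (Fin n)}
    {ψ : ℝ → EuclideanSpace ℝ (Fin n) → EuclideanSpace ℝ (Fin n)} (h : IsShearInverse v ψ) :
    IsShearInverse (fun x => -v x) fun s => ψ (-s) where
  smooth := h.smooth.comp (contDiff_fst.neg.prodMk contDiff_snd)
  left_inv s x := by simpa using h.left_inv (-s) x
  right_inv s y := by simpa using h.right_inv (-s) y

theorem IsShearInverse.eq_iff {v : EuclideanSpace ℝ (Fin n) → EuclideanSpace ℝ (Fin n)}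
    {ψ : ℝ → EuclideanSpace ℝ (Fin n) → EuclideanSpace ℝ (Fin n)} (h : IsShearInverse v ψ)
    {s : ℝ} {x y : EuclideanSpace ℝ (Fin n)} : x + s • v x = y ↔ x = ψ s y :=
  ⟨fun hy => by rw [← hy, h.left_inv], fun hx => by rw [hx, h.right_inv]⟩

theorem isOpen_exterior : IsOpen (exterior n) := by
  have h0 : Continuous fun q : EuclideanSpace ℝ (Fin (n + 1)) => q 0 := by fun_prop
  exact (isOpen_lt continuous_const h0).inter (isOpen_lt h0 continuous_const)

/-- The chart of the exterior in which the rays tangent to `v` are the vertical segments. -/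
def rayChart {v : EuclideanSpace ℝ (Fin n) → EuclideanSpace ℝ (Fin n)}
    {ψ : ℝ → EuclideanSpace ℝ (Fin n) → EuclideanSpace ℝ (Fin n)} (hv : ContDiff ℝ ∞ v)
    (h : IsShearInverse v ψ) :
    OpenPartialHomeomorph (EuclideanSpace ℝ (Fin (n + 1))) (ℝ × (Fin n → ℝ)) where
  toFun q := (q 0, (ψ (reach (q 0)) (vtail q)).ofLp)
  invFun y := vcons y.1 (WithLp.toLp 2 y.2 + reach y.1 • v (WithLp.toLp 2 y.2))
  source := exterior n
  target := Ioo 0 1 ×ˢ univ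
  map_source' q hq := ⟨hq, trivial⟩
  map_target' y hy := hy.1
  left_inv' q _ := by simp [h.right_inv]
  right_inv' y _ := by simp [h.left_inv]
  open_source := isOpen_exterior
  open_target := isOpen_Ioo.prod isOpen_univ
  continuousOn_toFun := by
    have hψ : Continuous (uncurry ψ) := h.smooth.continuous
    have ht : Continuous (vtail (n := n)) := (contDiff_vtail (m := ∞)).continuous
    have hr : Continuous reach := by unfold reach; fun_prop
    have h0 : Continuous fun q : EuclideanSpace ℝ (Fin (n + 1)) => q 0 := by fun_prop
    have h2 : Continuous fun q : EuclideanSpace ℝ (Fin (n + 1)) => ψ (reach (q 0)) (vtail q) :=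
      hψ.comp ((hr.comp h0).prodMk ht)
    exact (h0.prodMk ((PiLp.continuous_ofLp 2 _).comp h2)).continuousOn
  continuousOn_invFun := by
    have := hv.continuous
    have hr : Continuous reach := by unfold reach; fun_prop
    refine (contDiffOn_zero (𝕜 := ℝ)).1 (contDiffOn_vcons ?_ ?_) <;> rw [contDiffOn_zero] <;> fun_prop

theorem contDiffOn_rayChart {v : EuclideanSpace ℝ (Fin n) → EuclideanSpace ℝ (Fin n)}
    {ψ : ℝ → EuclideanSpace ℝ (Fin n) → EuclideanSpace ℝ (Fin n)} (hv : ContDiff ℝ ∞ v)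
    (h : IsShearInverse v ψ) : ContDiffOn ℝ ∞ (rayChart hv h) (exterior n) := by
  have h0 : ContDiff ℝ ∞ fun q : EuclideanSpace ℝ (Fin (n + 1)) => q 0 := by fun_prop
  have h1 : ContDiffOn ℝ ∞ (fun q : EuclideanSpace ℝ (Fin (n + 1)) => reach (q 0)) (exterior n) :=
    contDiffOn_reach.comp h0.contDiffOn fun q hq => hq
  exact h0.contDiffOn.prodMk (PiLp.contDiff_ofLp.comp_contDiffOn
    (h.smooth.comp_contDiffOn (h1.prodMk contDiff_vtail.contDiffOn)))

theorem contDiffOn_rayChart_symm {v : EuclideanSpace ℝ (Fin n) → EuclideanSpace ℝ (Fin n)}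
    {ψ : ℝ → EuclideanSpace ℝ (Fin n) → EuclideanSpace ℝ (Fin n)} (hv : ContDiff ℝ ∞ v)
    (h : IsShearInverse v ψ) : ContDiffOn ℝ ∞ (rayChart hv h).symm (Ioo 0 1 ×ˢ univ) := by
  have h1 : ContDiff ℝ ∞ fun y : ℝ × (Fin n → ℝ) =>
      (WithLp.toLp 2 y.2 : EuclideanSpace ℝ (Fin n)) := PiLp.contDiff_toLp.comp contDiff_snd
  have h2 : ContDiffOn ℝ ∞ (fun y : ℝ × (Fin n → ℝ) => reach y.1) (Ioo 0 1 ×ˢ univ) :=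
    contDiffOn_reach.comp contDiff_fst.contDiffOn fun y hy => hy.1
  exact contDiffOn_vcons contDiff_fst.contDiffOn
    (h1.contDiffOn.add (h2.smul (hv.comp h1).contDiffOn))

theorem IsShearInverse.mem_geodesicRay_iff
    {v : EuclideanSpace ℝ (Fin n) → EuclideanSpace ℝ (Fin n)}
    {ψ : ℝ → EuclideanSpace ℝ (Fin n) → EuclideanSpace ℝ (Fin n)} (h : IsShearInverse v ψ)
    {x : EuclideanSpace ℝ (Fin n)} (hx : ‖v x‖ = 1) {q : EuclideanSpace ℝ (Fin (n + 1))} :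
    q ∈ geodesicRay (vcons 1 x) (vcons 0 (v x)) ↔
      q ∈ exterior n ∧ x = ψ (reach (q 0)) (vtail q) := by
  rw [HopfBilliard.mem_geodesicRay_iff hx, h.eq_iff]

theorem IsShearInverse.forwardFoliates
    {v : EuclideanSpace ℝ (Fin n) → EuclideanSpace ℝ (Fin n)}
    {ψ : ℝ → EuclideanSpace ℝ (Fin n) → EuclideanSpace ℝ (Fin n)} (h : IsShearInverse v ψ)
    (hv : ContDiff ℝ ∞ v) (hv1 : ∀ x, ‖v x‖ = 1) : ForwardFoliates v where
  immersed := by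
    rintro _ ⟨x, rfl⟩
    exact isImmersedCurve_geodesicRay x (hv1 x)
  disjoint := by
    rintro _ ⟨x, rfl⟩ _ ⟨y, rfl⟩ hxy
    refine disjoint_left.2 fun q hqx hqy => hxy ?_
    have hx := ((h.mem_geodesicRay_iff (hv1 x)).1 hqx).2
    have hy := ((h.mem_geodesicRay_iff (hv1 y)).1 hqy).2
    rw [hx, ← hy]
  cover := by
    ext q
    simp only [sUnion_range, mem_iUnion, h.mem_geodesicRay_iff (hv1 _)]
    exact ⟨fun ⟨_, hq, _⟩ => hq, fun hq => ⟨_, hq, rfl⟩⟩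
  flat_chart q hq := by
    set e := rayChart hv h with he
    have hq' : e q ∈ e.target := e.map_source hq
    obtain ⟨ε, hε, hball⟩ := Metric.isOpen_iff.1 e.open_target _ hq'
    -- The restriction is made on the target side, since the target of a flat chart has to be a
    -- ball.
    set φ := (e.symm.restrOpen (Metric.ball (e q) ε) Metric.isOpen_ball).symm with hφ
    have hφe : ∀ p, φ p = e p := fun _ => rfl
    have htar : φ.target = Metric.ball (e q) ε := inter_eq_self_of_subset_right hball
    have hsrc : ∀ p, p ∈ φ.source ↔ p ∈ exterior n ∧ e p ∈ Metric.ball (e q) ε := by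
      intro p
      constructor
      · intro hp
        have h1 := φ.map_source hp
        have h2 := φ.left_inv hp
        rw [htar] at h1
        refine ⟨?_, h1⟩
        rw [← h2]
        exact e.map_target (hball h1)
      · rintro ⟨hp, hpb⟩
        have h1 : φ.symm (e p) ∈ φ.source := φ.map_target (htar ▸ hpb)
        have h2 : φ.symm (e p) = p := e.left_inv hp
        rwa [h2] at h1
    refine ⟨φ, (hsrc q).2 ⟨hq, Metric.mem_ball_self hε⟩, fun p hp => ((hsrc p).1 hp).1,
      (contDiffOn_rayChart hv h).mono fun p hp => ((hsrc p).1 hp).1,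
      (contDiffOn_rayChart_symm hv h).mono fun y hy => hball (htar ▸ hy), ⟨_, ε, hε, htar⟩, ?_⟩
    rintro _ ⟨x, rfl⟩
    -- The ray from `x` is the locus where the second component of the chart equals `x`, so one
    -- slice suffices.
    refine ⟨{x.ofLp}, countable_singleton _, ?_⟩
    ext y
    constructor
    · rintro ⟨p, ⟨hpx, hp⟩, rfl⟩
      exact ⟨φ.map_source hp,
        (congrArg WithLp.ofLp ((h.mem_geodesicRay_iff (hv1 x)).1 hpx).2).symm⟩
    · rintro ⟨hy, hyx⟩
      refine ⟨φ.symm y, ⟨?_, φ.map_target hy⟩, φ.right_inv hy⟩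
      refine (h.mem_geodesicRay_iff (hv1 x)).2 ⟨((hsrc _).1 (φ.map_target hy)).1, ?_⟩
      have h1 : (φ (φ.symm y)).2 = x.ofLp := by rw [φ.right_inv hy]; exact hyx
      exact (WithLp.ofLp_injective 2 h1).symm

theorem IsShearInverse.bifoliates {v : EuclideanSpace ℝ (Fin n) → EuclideanSpace ℝ (Fin n)}
    {ψ : ℝ → EuclideanSpace ℝ (Fin n) → EuclideanSpace ℝ (Fin n)} (h : IsShearInverse v ψ)
    (hv : ContDiff ℝ ∞ v) (hv1 : ∀ x, ‖v x‖ = 1) : Bifoliates v :=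
  ⟨h.forwardFoliates hv hv1, h.neg.forwardFoliates hv.neg fun x => by rw [norm_neg, hv1]⟩

/-! ### The outer billiard map -/

theorem isOuterBilliardMap_iff {v : EuclideanSpace ℝ (Fin n) → EuclideanSpace ℝ (Fin n)}
    (hv1 : ∀ x, ‖v x‖ = 1) {B : Equiv.Perm (exterior n)} :
    IsOuterBilliardMap v B ↔ ∀ (h : ℝ) (_ : 0 < h) (_ : h < 1) (x : EuclideanSpace ℝ (Fin n))
      (q : exterior n), q.1 = vcons h (x - reach h • v x) →
        (B q).1 = vcons h (x + reach h • v x) := by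
  constructor
  · intro hB h h0 h1 x q hq
    obtain ⟨t, ht, rfl⟩ := exists_inv_cosh_eq h0 h1
    obtain ⟨q', hq', hBq'⟩ := hB x _ (isGeodesicFrom_halfCircle x (hv1 x)) t ht
    rw [halfCircle_neg, halfCircle_of_pos _ _ ht, smul_neg, ← sub_eq_add_neg, ← hq] at hq'
    rw [← Subtype.ext hq', hBq', halfCircle_of_pos _ _ ht]
  · intro hB x γ hγ t ht
    rw [hγ.eq_halfCircle (hv1 x)]
    have h0 := inv_pos.2 (Real.cosh_pos t)
    have h1 := inv_cosh_lt_one ht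
    rw [halfCircle_neg, halfCircle_of_pos _ _ ht, halfCircle_of_pos _ _ ht, smul_neg,
      ← sub_eq_add_neg]
    exact ⟨⟨_, h0, h1⟩, rfl, hB _ h0 h1 x _ rfl⟩

/-- The outer billiard map of a field with invertible shears. -/
def IsShearInverse.billiard {v : EuclideanSpace ℝ (Fin n) → EuclideanSpace ℝ (Fin n)}
    {ψ : ℝ → EuclideanSpace ℝ (Fin n) → EuclideanSpace ℝ (Fin n)} (h : IsShearInverse v ψ) :
    Equiv.Perm (exterior n) where
  toFun q := ⟨vcons (q.1 0) (ψ (-reach (q.1 0)) (vtail q.1) +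
    reach (q.1 0) • v (ψ (-reach (q.1 0)) (vtail q.1))), q.2⟩
  invFun q := ⟨vcons (q.1 0) (ψ (reach (q.1 0)) (vtail q.1) +
    (-reach (q.1 0)) • v (ψ (reach (q.1 0)) (vtail q.1))), q.2⟩
  left_inv q := Subtype.ext (by simp only [vcons_apply_zero, vtail_vcons, h.left_inv, h.right_inv,
    vcons_vtail])
  right_inv q := Subtype.ext (by simp only [vcons_apply_zero, vtail_vcons, h.left_inv, h.right_inv,
    vcons_vtail])

theorem IsShearInverse.existsUnique_isOuterBilliardMap
    {v : EuclideanSpace ℝ (Fin n) → EuclideanSpace ℝ (Fin n)}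
    {ψ : ℝ → EuclideanSpace ℝ (Fin n) → EuclideanSpace ℝ (Fin n)} (h : IsShearInverse v ψ)
    (hv1 : ∀ x, ‖v x‖ = 1) : ∃! B : Equiv.Perm (exterior n), IsOuterBilliardMap v B := by
  simp only [isOuterBilliardMap_iff hv1]
  refine ⟨h.billiard, fun a _ _ x q hq => ?_, fun B hB => ?_⟩
  · have : x - reach a • v x = x + (-reach a) • v x := by rw [neg_smul, sub_eq_add_neg]
    simp only [IsShearInverse.billiard, Equiv.coe_fn_mk, hq, this, vcons_apply_zero, vtail_vcons,
      h.left_inv]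
  · ext1 q
    -- Uniqueness: every `q` lies on a backward ray, with foot `ψ (-s) (vtail q)`, so its image is
    -- prescribed.
    refine Subtype.ext (hB _ q.2.1 q.2.2 (ψ (-reach (q.1 0)) (vtail q.1)) q ?_)
    rw [sub_eq_add_neg, ← neg_smul, h.right_inv, vcons_vtail]

/-! ### The Hopf-like field -/

theorem hopfLike_denom_pos (p : EuclideanSpace ℝ (Fin 3)) :
    0 < p 0 ^ 2 + p 1 ^ 2 + p 2 ^ 2 + 1 := by positivity

/-- With `r² = y² + z²`, this is `(x² + 1 - r²)² + 4 r² (x² + 1) = (x² + 1 + r²)²`. -/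
theorem norm_hopfLike (p : EuclideanSpace ℝ (Fin 3)) : ‖hopfLike p‖ = 1 := by
  have h := (hopfLike_denom_pos p).ne'
  rw [← sq_eq_sq₀ (norm_nonneg _) zero_le_one, EuclideanSpace.real_norm_sq_eq]
  simp only [hopfLike, Fin.sum_univ_three, PiLp.smul_apply, smul_eq_mul, Matrix.cons_val]
  field_simp
  ring

theorem contDiff_hopfLike : ContDiff ℝ ∞ hopfLike := by
  have h := fun p => (hopfLike_denom_pos p).ne'
  refine (ContDiff.div contDiff_const (by fun_prop) h).smul ?_
  rw [contDiff_euclidean]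
  intro i
  fin_cases i <;> simp <;> fun_prop

theorem isSmoothUnitField_hopfLike : IsSmoothUnitField hopfLike :=
  ⟨contDiff_hopfLike, fun x => by
    rw [hypNorm_eq (by simp), norm_vcons_zero, norm_hopfLike, vcons_apply_zero, div_one]⟩

/-! ### The stereographic image of the Hopf field. -/

theorem fderiv_stereo {q : EuclideanSpace ℝ (Fin 4)} (hq : q 0 ≠ 1)
    (u : EuclideanSpace ℝ (Fin 4)) : fderiv ℝ stereo q u =
      (1 / (1 - q 0)) • !₂[u 1, u 2, u 3] + (u 0 / (1 - q 0) ^ 2) • !₂[q 1, q 2, q 3] := by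
  have hne : 1 - q 0 ≠ 0 := sub_ne_zero.2 hq.symm
  have hd : DifferentiableAt ℝ stereo q := by
    have h1 : DifferentiableAt ℝ (fun q : EuclideanSpace ℝ (Fin 4) => 1 / (1 - q 0)) q := by
      fun_prop (disch := exact hne)
    refine h1.smul ?_
    rw [differentiableAt_euclidean]
    intro i
    fin_cases i <;> simp <;> fun_prop
  rw [← hd.lineDeriv_eq_fderiv]
  refine HasDerivAt.deriv (hasDerivAt_euclidean.2 fun i => ?_)
  have hl : ∀ j : Fin 4, HasDerivAt (fun t : ℝ => q j + t * u j) (u j) 0 := fun j => by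
    simpa using ((hasDerivAt_id (0 : ℝ)).mul_const (u j)).const_add (q j)
  have key : ∀ j : Fin 4, HasDerivAt (fun t : ℝ => 1 / (1 - (q 0 + t * u 0)) * (q j + t * u j))
      (1 / (1 - q 0) * u j + u 0 / (1 - q 0) ^ 2 * q j) 0 := fun j => by
    refine (((hasDerivAt_const (0 : ℝ) (1 : ℝ)).div ((hl 0).const_sub 1) (by simpa using hne)).mul
      (hl j)).congr_deriv ?_
    simp
    ring
  fin_cases i
  · simpa [stereo] using key 1
  · simpa [stereo] using key 2
  · simpa [stereo] using key 3

theorem fderiv_stereo_neg_hopfField {q : EuclideanSpace ℝ (Fin 4)} (hq : q ∈ Metric.sphere 0 1)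
    (hq0 : q 0 ≠ 1) : fderiv ℝ stereo q (-hopfField q) = (1 / (1 - q 0)) • hopfLike (stereo q) := by
  have hne : 1 - q 0 ≠ 0 := sub_ne_zero.2 hq0.symm
  have hs : q 0 ^ 2 + q 1 ^ 2 + q 2 ^ 2 + q 3 ^ 2 = 1 := by
    have : ‖q‖ ^ 2 = 1 := by rw [mem_sphere_zero_iff_norm.1 hq, one_pow]
    rwa [EuclideanSpace.real_norm_sq_eq, Fin.sum_univ_four] at this
  -- On the sphere, `‖stereo q‖² + 1 = 2 / (1 - q 0)`: the denominator of `hopfLike`.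
  have hD : (1 / (1 - q 0) * q 1) ^ 2 + (1 / (1 - q 0) * q 2) ^ 2 + (1 / (1 - q 0) * q 3) ^ 2 + 1 =
      2 / (1 - q 0) := by
    field_simp
    linear_combination hs
  rw [fderiv_stereo hq0]
  ext i
  fin_cases i
  · simp [hopfField, stereo, hopfLike] at hD ⊢
    rw [hD]
    field_simp
    linear_combination hs
  · simp [hopfField, stereo, hopfLike] at hD ⊢
    rw [hD]
    field_simp
    ring
  · simp [hopfField, stereo, hopfLike] at hD ⊢
    rw [hD]
    field_simp
    ring

theorem hopfLike_stereo {q : EuclideanSpace ℝ (Fin 4)} (hq : q ∈ Metric.sphere 0 1)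
    (hq0 : q 0 ≠ 1) : hopfLike (stereo q) = ‖fderiv ℝ stereo q (-hopfField q)‖⁻¹ •
      fderiv ℝ stereo q (-hopfField q) := by
  have hle : q 0 ≤ 1 := by
    rw [← mem_sphere_zero_iff_norm.1 hq]
    exact (le_abs_self _).trans (PiLp.norm_apply_le q 0)
  have hpos : 0 < 1 - q 0 := sub_pos.2 (lt_of_le_of_ne hle hq0)
  rw [fderiv_stereo_neg_hopfField hq hq0, norm_smul, norm_hopfLike, smul_smul, mul_one,
    Real.norm_of_nonneg (by positivity), inv_mul_cancel₀ (by positivity), one_smul]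

/-- The first coordinate of `hopfLike x` in terms of `y = x + s • hopfLike x`. -/
def hopfSlope (s : ℝ) (y : EuclideanSpace ℝ (Fin 3)) : ℝ :=
  ((y 0 + s) ^ 2 + 1 - (y 1 ^ 2 + y 2 ^ 2)) / ((y 0 + s) ^ 2 + 1 + (y 1 ^ 2 + y 2 ^ 2))

/-- The inverse of `x ↦ x + s • hopfLike x`. With `y = (a, w)`, `w ∈ ℂ`, it is
`(b, w * (b + i) / (a + s + i))`, where `b = a - s * hopfSlope s y`. -/
def hopfShearInverse (s : ℝ) (y : EuclideanSpace ℝ (Fin 3)) : EuclideanSpace ℝ (Fin 3) :=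
  !₂[y 0 - s * hopfSlope s y,
    (y 1 * ((y 0 - s * hopfSlope s y) * (y 0 + s) + 1) -
      y 2 * ((y 0 + s) - (y 0 - s * hopfSlope s y))) / ((y 0 + s) ^ 2 + 1),
    (y 1 * ((y 0 + s) - (y 0 - s * hopfSlope s y)) +
      y 2 * ((y 0 - s * hopfSlope s y) * (y 0 + s) + 1)) / ((y 0 + s) ^ 2 + 1)]

theorem contDiff_hopfShearInverse : ContDiff ℝ ∞ (uncurry hopfShearInverse) := by
  have hc : ContDiff ℝ ∞ fun z : ℝ × EuclideanSpace ℝ (Fin 3) => hopfSlope z.1 z.2 :=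
    ContDiff.div (by fun_prop) (by fun_prop) fun z => by positivity
  rw [contDiff_euclidean]
  intro i
  fin_cases i
  · simp [hopfShearInverse, uncurry]
    fun_prop
  · simp only [hopfShearInverse, uncurry]
    exact ContDiff.div (by fun_prop) (by fun_prop) fun z => by positivity
  · simp only [hopfShearInverse, uncurry]
    exact ContDiff.div (by fun_prop) (by fun_prop) fun z => by positivity

theorem hopfShearInverse_right_inv (s : ℝ) (y : EuclideanSpace ℝ (Fin 3)) :
    hopfShearInverse s y + s • hopfLike (hopfShearInverse s y) = y := by
  obtain ⟨c, hc⟩ : ∃ c, c = hopfSlope s y := ⟨_, rfl⟩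
  obtain ⟨b, hb⟩ : ∃ b, b = y 0 - s * c := ⟨_, rfl⟩
  obtain ⟨A, hA⟩ : ∃ A, A = y 0 + s := ⟨_, rfl⟩
  have hK : A ^ 2 + 1 ≠ 0 := by positivity
  have hKQ : A ^ 2 + 1 + (y 1 ^ 2 + y 2 ^ 2) ≠ 0 := by positivity
  have hP : b ^ 2 + 1 ≠ 0 := by positivity
  have hc' : c * (A ^ 2 + 1 + (y 1 ^ 2 + y 2 ^ 2)) = A ^ 2 + 1 - (y 1 ^ 2 + y 2 ^ 2) := by
    rw [hc, hopfSlope, ← hA]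
    field_simp
  -- This is `A - b = s (1 + c)` with denominators cleared; it is the relation that makes all three
  -- coordinates agree.
  have hAb : (A - b) * (A ^ 2 + 1 + (y 1 ^ 2 + y 2 ^ 2)) = 2 * s * (A ^ 2 + 1) := by
    rw [hb, hA] at *
    linear_combination s * hc'
  have h0 : hopfShearInverse s y = !₂[b, (y 1 * (b * A + 1) - y 2 * (A - b)) / (A ^ 2 + 1),
      (y 1 * (A - b) + y 2 * (b * A + 1)) / (A ^ 2 + 1)] := by
    rw [hopfShearInverse, ← hc, ← hb, ← hA]
  -- The planar part is `w (b + i) / (A + i)`, so its squared modulus is `|w|² (b² + 1) / (A² + 1)`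
  -- and the denominator factors.
  have hD : b ^ 2 + ((y 1 * (b * A + 1) - y 2 * (A - b)) / (A ^ 2 + 1)) ^ 2 +
      ((y 1 * (A - b) + y 2 * (b * A + 1)) / (A ^ 2 + 1)) ^ 2 + 1 =
      (b ^ 2 + 1) * (A ^ 2 + 1 + (y 1 ^ 2 + y 2 ^ 2)) / (A ^ 2 + 1) := by
    field_simp
    ring
  rw [h0]
  ext i
  fin_cases i
  · simp [hopfLike]
    rw [hD]
    field_simp
    linear_combination ((b ^ 2 + 1) * (A ^ 2 + 1) * (A ^ 2 + 1 + (y 1 ^ 2 + y 2 ^ 2))) * hA -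
      (b ^ 2 + 1) * (A ^ 2 + 1) * hAb
  · simp [hopfLike]
    rw [hD]
    field_simp
    linear_combination -(b * (y 1 * (b * A + 1) - y 2 * (A - b)) +
      (y 1 * (A - b) + (b * A + 1) * y 2)) * hAb
  · simp [hopfLike]
    rw [hD]
    field_simp
    linear_combination -(b * (y 1 * (A - b) + y 2 * (A * b + 1)) -
      (y 1 * (A * b + 1) - (A - b) * y 2)) * hAb

theorem hopfShearInverse_left_inv (s : ℝ) (x : EuclideanSpace ℝ (Fin 3)) :
    hopfShearInverse s (x + s • hopfLike x) = x := by
  have hD := (hopfLike_denom_pos x).ne'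
  obtain ⟨D, hDdef⟩ : ∃ D, D = x 0 ^ 2 + x 1 ^ 2 + x 2 ^ 2 + 1 := ⟨_, rfl⟩
  obtain ⟨y, hy⟩ : ∃ y, y = x + s • hopfLike x := ⟨_, rfl⟩
  rw [← hDdef] at hD
  have hP : x 0 ^ 2 + 1 ≠ 0 := by positivity
  have hv : hopfLike x 0 = 2 * (x 0 ^ 2 + 1) / D - 1 := by
    simp only [hopfLike, ← hDdef, PiLp.smul_apply, smul_eq_mul, Matrix.cons_val]
    field_simp
    linear_combination hDdef
  have hA : y 0 + s = x 0 + 2 * s * (x 0 ^ 2 + 1) / D := by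
    simp only [hy, PiLp.add_apply, PiLp.smul_apply, smul_eq_mul, hv]
    ring
  have h1 : y 1 = (x 1 * (D + 2 * s * x 0) + 2 * s * x 2) / D := by
    simp only [hy, hopfLike, ← hDdef, PiLp.add_apply, PiLp.smul_apply, smul_eq_mul,
      Matrix.cons_val]
    field_simp
    ring
  have h2 : y 2 = (x 2 * (D + 2 * s * x 0) - 2 * s * x 1) / D := by
    simp only [hy, hopfLike, ← hDdef, PiLp.add_apply, PiLp.smul_apply, smul_eq_mul,
      Matrix.cons_val]
    field_simp
    ring
  -- `M = |μ|²` for the common complex factor `μ` of `w` and `a + s + i`; it cancels in `hopfSlope`.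
  obtain ⟨M, hM⟩ : ∃ M, M = ((D + 2 * s * x 0) ^ 2 + 4 * s ^ 2) / D ^ 2 := ⟨_, rfl⟩
  have hK : (y 0 + s) ^ 2 + 1 = (x 0 ^ 2 + 1) * M := by
    rw [hA, hM]
    field_simp
    ring
  have hQ : y 1 ^ 2 + y 2 ^ 2 = (x 1 ^ 2 + x 2 ^ 2) * M := by
    rw [h1, h2, hM]
    field_simp
    ring
  have hM0 : M ≠ 0 := by
    rintro rfl
    have : (y 0 + s) ^ 2 + 1 ≠ 0 := by positivity
    exact this (by rw [hK, mul_zero])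
  have hc : hopfSlope s y = hopfLike x 0 := by
    rw [hopfSlope, hK, hQ, hv, ← add_mul, ← sub_mul, mul_div_mul_right _ _ hM0,
      show x 0 ^ 2 + 1 + (x 1 ^ 2 + x 2 ^ 2) = D by rw [hDdef]; ring]
    field_simp
    linear_combination hDdef
  have hb : y 0 - s * hopfSlope s y = x 0 := by
    rw [hc, hy]
    simp
  rw [← hy, hopfShearInverse, hb, hK, hA, h1, h2]
  ext i
  fin_cases i
  · rfl
  · simp
    rw [div_eq_iff (mul_ne_zero hP hM0), hM]
    field_simp
    ring
  · simp
    rw [div_eq_iff (mul_ne_zero hP hM0), hM]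
    field_simp
    ring

theorem isShearInverse_hopfLike : IsShearInverse hopfLike hopfShearInverse :=
  ⟨contDiff_hopfShearInverse, hopfShearInverse_left_inv, hopfShearInverse_right_inv⟩

/-! ### Orbits of the outer billiard map of the Hopf-like field -/

theorem vcons_three (h a b c : ℝ) : vcons h !₂[a, b, c] = !₂[h, a, b, c] := by
  ext i
  fin_cases i <;> rfl

variable {B : Equiv.Perm (exterior 3)} {h : ℝ}

theorem billiard_axis (hB : IsOuterBilliardMap hopfLike B) (h0 : 0 < h) (h1 : h < 1) {x : ℝ}
    {q : exterior 3} (hq : q.1 = !₂[h, x, 0, 0]) :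
    (B q).1 = !₂[h, x + 2 * Real.sqrt (1 - h ^ 2), 0, 0] := by
  rw [isOuterBilliardMap_iff norm_hopfLike] at hB
  have hv : ∀ a : ℝ, hopfLike !₂[a, 0, 0] = !₂[1, 0, 0] := fun a => by
    have : a ^ 2 + 1 ≠ 0 := by positivity
    ext i
    fin_cases i <;> simp [hopfLike, this]
  -- The tangency point lies halfway between `q` and its image.
  rw [hB h h0 h1 !₂[x + reach h, 0, 0] q, ← vcons_three, hv]
  · congr 1
    ext i
    fin_cases i <;> simp [reach]
    ring
  · rw [hq, ← vcons_three, hv]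
    congr 1
    ext i
    fin_cases i <;> simp

theorem zpow_billiard_axis (hB : IsOuterBilliardMap hopfLike B) (h0 : 0 < h) (h1 : h < 1)
    (m : ℤ) : ∀ {x : ℝ} {q : exterior 3}, q.1 = !₂[h, x, 0, 0] →
      ((B ^ m) q).1 = !₂[h, x + 2 * m * Real.sqrt (1 - h ^ 2), 0, 0] := by
  induction m with
  | zero => intro x q hq; simpa using hq
  | succ m ih =>
    intro x q hq
    rw [zpow_add_one, Equiv.Perm.mul_apply, ih (billiard_axis hB h0 h1 hq)]
    push_cast
    ring_nf
  | pred m ih =>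
    intro x q hq
    have key := billiard_axis hB h0 h1 (x := x - 2 * Real.sqrt (1 - h ^ 2))
      (q := ⟨!₂[h, x - 2 * Real.sqrt (1 - h ^ 2), 0, 0], h0, h1⟩) rfl
    have hq' : B⁻¹ q = ⟨!₂[h, x - 2 * Real.sqrt (1 - h ^ 2), 0, 0], h0, h1⟩ := by
      rw [Equiv.Perm.inv_eq_iff_eq]
      refine Subtype.ext ?_
      rw [key, hq, sub_add_cancel]
    rw [zpow_sub_one, Equiv.Perm.mul_apply, ih (congrArg Subtype.val hq')]
    push_cast
    ring_nf

theorem axis_orbit_unbounded (hB : IsOuterBilliardMap hopfLike B) (h0 : 0 < h) (h1 : h < 1)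
    {x : ℝ} {q : exterior 3} (hq : q.1 = !₂[h, x, 0, 0]) (R : ℝ) :
    ∃ m : ℤ, R < hypDist q.1 ((B ^ m) q).1 := by
  have hs : 0 < Real.sqrt (1 - h ^ 2) := Real.sqrt_pos.2 (by nlinarith)
  -- This `m` pushes the `x`-coordinate, hence the norm, beyond `exp R * ‖q‖`.
  obtain ⟨m, hm⟩ := exists_nat_gt
    ((Real.exp (R + Real.log ‖q.1‖) - x) / (2 * Real.sqrt (1 - h ^ 2)))
  rw [div_lt_iff₀ (by positivity)] at hm
  refine ⟨m, lt_of_lt_of_le ?_ (log_norm_sub_log_norm_le_hypDist q.2.1 ((B ^ (m : ℤ)) q).2.1)⟩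
  rw [lt_sub_iff_add_lt, Real.lt_log_iff_exp_lt (norm_pos_iff.2 fun h => by
    have := ((B ^ (m : ℤ)) q).2.1
    rw [h] at this
    exact lt_irrefl _ this)]
  refine lt_of_lt_of_le ?_ ((le_abs_self _).trans (PiLp.norm_apply_le ((B ^ (m : ℤ)) q).1 1))
  rw [zpow_billiard_axis hB h0 h1 m hq]
  simp
  linarith

/-! ### The rotation of the circle `C_h`. -/

theorem cos_rotAngle (h : ℝ) (hh : h ^ 2 ≤ 1) : Real.cos (rotAngle h) = h ^ 2 / (2 - h ^ 2) := by
  have h2 : 2 - h ^ 2 ≠ 0 := by linarith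
  rw [rotAngle, Real.cos_two_mul, Real.cos_sq_arctan, Real.sq_sqrt (by linarith)]
  rw [show 1 + (1 - h ^ 2) = 2 - h ^ 2 by ring]
  field_simp
  ring

theorem sin_rotAngle (h : ℝ) (hh : h ^ 2 ≤ 1) :
    Real.sin (rotAngle h) = 2 * reach h / (2 - h ^ 2) := by
  have h2 : 0 < 2 - h ^ 2 := by linarith
  have h3 : 1 + Real.sqrt (1 - h ^ 2) ^ 2 = 2 - h ^ 2 := by
    rw [Real.sq_sqrt (by linarith)]
    ring
  rw [rotAngle, Real.sin_two_mul, Real.sin_arctan, Real.cos_arctan, h3, reach]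
  have h4 := Real.sq_sqrt h2.le
  have h5 := (Real.sqrt_pos.2 h2).ne'
  field_simp
  rw [h4]

theorem billiard_circle (hB : IsOuterBilliardMap hopfLike B) (h0 : 0 < h) (h1 : h < 1)
    {q : exterior 3} (hq : q ∈ circleC h) : (B q).1 = !₂[h, 0,
      Real.cos (rotAngle h) * q.1 2 + Real.sin (rotAngle h) * q.1 3,
      -Real.sin (rotAngle h) * q.1 2 + Real.cos (rotAngle h) * q.1 3] := by
  rw [isOuterBilliardMap_iff norm_hopfLike] at hB
  obtain ⟨hq0, hq1, hq2⟩ := hq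
  have hh : h ^ 2 ≤ 1 := by nlinarith
  have h2 : 2 - h ^ 2 ≠ 0 := by linarith
  have hs : reach h ^ 2 = 1 - h ^ 2 := Real.sq_sqrt (by linarith)
  have hqe : q.1 = vcons h !₂[0, q.1 2, q.1 3] := by
    rw [vcons_three]
    ext i
    fin_cases i <;> simp [hq0, hq1]
  -- The foot `(a, b)` solves `q₂ = a - s b`, `q₃ = b + s a` with `s = reach h`; the determinant is
  -- `1 + s² = 2 - h²`.
  obtain ⟨a, ha⟩ : ∃ a, a = (q.1 2 + reach h * q.1 3) / (2 - h ^ 2) := ⟨_, rfl⟩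
  obtain ⟨b, hb⟩ : ∃ b, b = (q.1 3 - reach h * q.1 2) / (2 - h ^ 2) := ⟨_, rfl⟩
  have hab : a ^ 2 + b ^ 2 = 1 := by
    rw [ha, hb]
    field_simp
    linear_combination (1 + reach h ^ 2) * hq2 + (2 - h ^ 2) * hs
  have hv : hopfLike !₂[0, a, b] = !₂[0, b, -a] := by
    have hd : a ^ 2 + b ^ 2 + 1 = 2 := by rw [hab]; norm_num
    ext i
    fin_cases i <;> simp [hopfLike, hd]
    linarith
  rw [hB h h0 h1 !₂[0, a, b] q, hv, ← vcons_three, cos_rotAngle h hh, sin_rotAngle h hh]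
  · congr 1
    ext i
    fin_cases i <;> simp
    · rw [ha, hb]
      field_simp
      linear_combination -q.1 2 * hs
    · rw [ha, hb]
      field_simp
      linear_combination -q.1 3 * hs
  · rw [hv]
    refine hqe.trans ?_
    congr 1
    ext i
    fin_cases i <;> simp
    · rw [ha, hb]
      field_simp
      linear_combination -q.1 2 * hs
    · rw [ha, hb]
      field_simp
      linear_combination -q.1 3 * hs

theorem mem_circleC_of_eq {q r : exterior 3} (hq : q ∈ circleC h) {θ : ℝ} (hr : r.1 = !₂[h, 0,
    Real.cos θ * q.1 2 + Real.sin θ * q.1 3, -Real.sin θ * q.1 2 + Real.cos θ * q.1 3]) :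
    r ∈ circleC h := by
  refine ⟨by rw [hr]; rfl, by rw [hr]; rfl, ?_⟩
  rw [hr, ← hq.2.2]
  simp
  linear_combination ((q.1 2) ^ 2 + (q.1 3) ^ 2) * Real.sin_sq_add_cos_sq θ

theorem eq_of_mem_circleC {q : exterior 3} (hq : q ∈ circleC h) :
    q.1 = !₂[h, 0, q.1 2, q.1 3] := by
  ext i
  fin_cases i <;> simp [hq.1, hq.2.1]

theorem iterate_billiard_circle (hB : IsOuterBilliardMap hopfLike B) (h0 : 0 < h) (h1 : h < 1)
    {q : exterior 3} (hq : q ∈ circleC h) (m : ℕ) : (B^[m] q).1 = !₂[h, 0,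
      Real.cos (m * rotAngle h) * q.1 2 + Real.sin (m * rotAngle h) * q.1 3,
      -Real.sin (m * rotAngle h) * q.1 2 + Real.cos (m * rotAngle h) * q.1 3] := by
  induction m with
  | zero => simpa using eq_of_mem_circleC hq
  | succ m ih =>
    rw [iterate_succ_apply', billiard_circle hB h0 h1 (mem_circleC_of_eq hq ih), ih]
    push_cast
    rw [add_mul, one_mul, Real.cos_add, Real.sin_add]
    ext i
    fin_cases i <;> simp <;> ring

theorem image_circleC (hB : IsOuterBilliardMap hopfLike B) (h0 : 0 < h) (h1 : h < 1) :
    B '' circleC h = circleC h := by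
  refine Subset.antisymm ?_ fun q hq => ?_
  · rintro _ ⟨q, hq, rfl⟩
    exact mem_circleC_of_eq hq (billiard_circle hB h0 h1 hq)
  · let r : exterior 3 := ⟨!₂[h, 0,
      Real.cos (-rotAngle h) * q.1 2 + Real.sin (-rotAngle h) * q.1 3,
      -Real.sin (-rotAngle h) * q.1 2 + Real.cos (-rotAngle h) * q.1 3], h0, h1⟩
    have hr : r ∈ circleC h := mem_circleC_of_eq hq rfl
    refine ⟨r, hr, Subtype.ext ?_⟩
    rw [billiard_circle hB h0 h1 hr, eq_of_mem_circleC hq]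
    have := Real.sin_sq_add_cos_sq (rotAngle h)
    ext i
    fin_cases i <;> simp [r]
    · linear_combination q.1 2 * this
    · linear_combination q.1 3 * this

theorem mem_periodicPts_circle_iff (hB : IsOuterBilliardMap hopfLike B) (h0 : 0 < h) (h1 : h < 1)
    {q : exterior 3} (hq : q ∈ circleC h) :
    q ∈ periodicPts B ↔ ∃ a : ℚ, rotAngle h = a * Real.pi := by
  constructor
  · rintro ⟨m, hm, hfix⟩
    have hit := iterate_billiard_circle hB h0 h1 hq m
    rw [hfix.eq] at hit
    have h2 := congrArg (fun p => p 2) hit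
    have h3 := congrArg (fun p => p 3) hit
    simp at h2 h3
    have hpos : q.1 2 ^ 2 + q.1 3 ^ 2 ≠ 0 := by
      rw [hq.2.2]
      nlinarith
    -- Pairing the fixed-point equations with `(q₂, q₃)` cancels the sine terms.
    have hcos : Real.cos (m * rotAngle h) = 1 := by
      apply mul_right_cancel₀ hpos
      linear_combination -q.1 2 * h2 - q.1 3 * h3
    obtain ⟨k, hk⟩ := (Real.cos_eq_one_iff _).1 hcos
    have hm' : (m : ℝ) ≠ 0 := by exact_mod_cast hm.ne'
    refine ⟨2 * k / m, ?_⟩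
    push_cast
    field_simp
    linarith
  · rintro ⟨a, ha⟩
    -- The factor 2 makes the total angle `a.num` full turns; the period need not be minimal.
    refine ⟨2 * a.den, by have := a.den_pos; omega, Subtype.ext ?_⟩
    have hθ : ((2 * a.den : ℕ) : ℝ) * rotAngle h = a.num * (2 * Real.pi) := by
      have : (a : ℝ) * a.den = a.num := by exact_mod_cast Rat.mul_den_eq_num a
      rw [ha]
      push_cast
      linear_combination 2 * Real.pi * this
    rw [iterate_billiard_circle hB h0 h1 hq, hθ, Real.cos_int_mul_two_pi,
      show (a.num : ℝ) * (2 * Real.pi) = ((2 * a.num : ℤ) : ℝ) * Real.pi by push_cast; ring,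
      Real.sin_int_mul_pi]
    simpa using (eq_of_mem_circleC hq).symm

end HopfBilliard

end

theorem mainTheorem6 :
    -- the field is the normalized stereographic projection of (minus) the Hopf field
    (∀ q : EuclideanSpace ℝ (Fin 4), q ∈ Metric.sphere 0 1 → q 0 ≠ 1 →
      HopfBilliard.hopfLike (HopfBilliard.stereo q) =
        ‖fderiv ℝ HopfBilliard.stereo q (-HopfBilliard.hopfField q)‖⁻¹ •
          fderiv ℝ HopfBilliard.stereo q (-HopfBilliard.hopfField q)) ∧
    HopfBilliard.IsSmoothUnitField HopfBilliard.hopfLike ∧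
    -- it bifoliates the exterior, and has exactly one invertible outer billiard map
    HopfBilliard.Bifoliates HopfBilliard.hopfLike ∧
    (∃! B : Equiv.Perm (HopfBilliard.exterior 3),
      HopfBilliard.IsOuterBilliardMap HopfBilliard.hopfLike B) ∧
    ∀ B : Equiv.Perm (HopfBilliard.exterior 3),
      HopfBilliard.IsOuterBilliardMap HopfBilliard.hopfLike B →
      ∀ h : ℝ, 0 < h → h < 1 →
        -- (a)
        (∀ (x : ℝ) (q : HopfBilliard.exterior 3), q.1 = !₂[h, x, 0, 0] →
          (∀ m : ℤ, ((B ^ m) q).1 = !₂[h, x + 2 * m * Real.sqrt (1 - h ^ 2), 0, 0]) ∧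
          ∀ R : ℝ, ∃ m : ℤ, R < HopfBilliard.hypDist q.1 ((B ^ m) q).1) ∧
        -- (b)
        B '' HopfBilliard.circleC h = HopfBilliard.circleC h ∧
        -- (c)
        (∀ q ∈ HopfBilliard.circleC h,
          (B q).1 = !₂[h, 0,
            Real.cos (HopfBilliard.rotAngle h) * q.1 2 + Real.sin (HopfBilliard.rotAngle h) * q.1 3,
            -Real.sin (HopfBilliard.rotAngle h) * q.1 2 +
              Real.cos (HopfBilliard.rotAngle h) * q.1 3]) ∧
        (∀ q ∈ HopfBilliard.circleC h,
          q ∈ Function.periodicPts B ↔ ∃ a : ℚ, HopfBilliard.rotAngle h = a * Real.pi) := by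
  refine ⟨fun q hq hq0 => HopfBilliard.hopfLike_stereo hq hq0,
    HopfBilliard.isSmoothUnitField_hopfLike,
    HopfBilliard.isShearInverse_hopfLike.bifoliates HopfBilliard.contDiff_hopfLike
      HopfBilliard.norm_hopfLike,
    HopfBilliard.isShearInverse_hopfLike.existsUnique_isOuterBilliardMap
      HopfBilliard.norm_hopfLike, fun B hB h h0 h1 => ⟨fun x q hq => ⟨fun m => ?_, ?_⟩, ?_, ?_, ?_⟩⟩
  · exact HopfBilliard.zpow_billiard_axis hB h0 h1 m hq
  · exact HopfBilliard.axis_orbit_unbounded hB h0 h1 hq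
  · exact HopfBilliard.image_circleC hB h0 h1
  · exact fun q hq => HopfBilliard.billiard_circle hB h0 h1 hq
  · exact fun q hq => HopfBilliard.mem_periodicPts_circle_iff hB h0 h1 hq
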